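/- Let $G(n,q)$ denote the Erdős–Rényi random graph: a graph on $n$ labelled vertices in which each of the $\binom n2$ possible edges is present independently with probability $q$. All graphs are finite and simple, and a graph class is a class of graphs closed under isomorphism. For $d\in\mathbb N=\{0,1,2,\dots\}$, a graph $H$ is a shallow minor of a graph $G$ at depth $d$ if there is a subgraph $X$ of $G$, every connected component of which has radius at most $d$, such that $H$ is isomorphic to a subgraph of the simple graph obtained from $G$ by contracting each component of $X$ into a single vertex. Here the radius of a connected graph $C$ is $\min_{r\in V(C)}\max_{v\in V(C)}\mathrm{dist}_C(r,v)$. A graph class $\mathcal C$ has bounded expansion if there is a function $f:\mathbb N\to\mathbb R$ such that for every $d\in\mathbb N$, $$\nabla_d(\mathcal C)=\sup\left\{\frac{|E(H)|}{|V(H)|} : H \text{ a non-empty shallow minor at depth } d \text{ of some graph in } \mathcal C\right\}\le f(d).$$ **Theorem.** For every real $p>0$ there exists a graph class $\mathcal R_p$ with bounded expansion such that $G(n,p/n)$ belongs to $\mathcal R_p$ asymptotically almost surely, that is, $$\lim_{n\to\infty}\Pr\left[G(n,p/n)\in\mathcal R_p\right]=1.$$ (The random graph $G(n,p/n)$ is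 defined as soon as $n\ge p$ and $n\geq 1$.) -/

import Mathlib

namespace BoundedExpansion

/-- A finite simple graph, bundled with its vertex set. -/
structure FiniteGraph where
  V : Type
  finite : Finite V
  graph : SimpleGraph V

/-- The bundled version of a graph on a finite vertex set. -/
def FiniteGraph.of {V : Type} [h : Finite V] (G : SimpleGraph V) : FiniteGraph := ⟨V, h, G⟩

/-- The density `‖G‖ / |G|` (number of edges over number of vertices).
The graph without vertices gets density `0 / 0 = 0`. -/
noncomputable def FiniteGraph.density (G : FiniteGraph) : ℝ :=
  (G.graph.edgeSet.ncard : ℝ) / (Nat.card G.V : ℝ)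

/-- A class of (unlabelled) finite simple graphs: a collection of finite graphs that is closed
under isomorphism. -/
structure GraphClass where
  carrier : Set FiniteGraph
  iso_closed : ∀ G H : FiniteGraph, Nonempty (G.graph ≃g H.graph) → G ∈ carrier → H ∈ carrier

/-- The simple graph obtained from `G` by contracting each connected component of `X`
into a single vertex. -/
def contract {V : Type} (G X : SimpleGraph V) : SimpleGraph X.ConnectedComponent where
  Adj C D := C ≠ D ∧ ∃ u ∈ C.supp, ∃ v ∈ D.supp, G.Adj u v
  symm := ⟨fun _ _ ⟨hne, u, hu, v, hv, h⟩ => ⟨hne.symm, v, hv, u, hu, h.symm⟩⟩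
  loopless := ⟨fun _ h => h.1 rfl⟩

/-- `H` is a shallow minor of `G` at depth `d`: there is a subgraph `X` of `G`, all of whose
connected components have radius at most `d`, such that `H` is (isomorphic to) a subgraph of the
graph obtained from `G` by contracting each component of `X`. Vertices of `G` that are not to be
contracted are isolated vertices of `X`, of radius `0`, so that `X` may be taken spanning. -/
def IsShallowMinor (d : ℕ) (H G : FiniteGraph) : Prop :=
  ∃ X : SimpleGraph G.V, X ≤ G.graph ∧
    (∀ C : X.ConnectedComponent, C.toSimpleGraph.radius ≤ (d : ℕ∞)) ∧
    H.graph.IsContained (contract G.graph X)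

/-- The set of all shallow minors at depth `d` of graphs in the class `𝒞`. -/
def GraphClass.shallowMinors (𝒞 : GraphClass) (d : ℕ) : Set FiniteGraph :=
  {H | ∃ G ∈ 𝒞.carrier, IsShallowMinor d H G}

/-- The greatest reduced average density (grad) of rank `d` of a graph class: the supremum,
in the extended reals, of the densities of its shallow minors at depth `d`. -/
noncomputable def GraphClass.grad (𝒞 : GraphClass) (d : ℕ) : EReal :=
  ⨆ H ∈ 𝒞.shallowMinors d, ((H.density : ℝ) : EReal)

/-- A class has bounded expansion if its grads of all ranks are bounded by a real-valued
expansion function. -/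
def GraphClass.HasBoundedExpansion (𝒞 : GraphClass) : Prop :=
  ∃ f : ℕ → ℝ, ∀ d : ℕ, 𝒞.grad d ≤ ((f d : ℝ) : EReal)

/-- The Erdős–Rényi random graph `G(n, q)` on `n` vertices, as a probability measure: each of the
possible edges is present independently with probability `q`. A real number `q` outside `[0, 1]`
is replaced by the nearest point of `[0, 1]`. -/
noncomputable def erdosRenyi (n : ℕ) (q : ℝ) : MeasureTheory.Measure (SimpleGraph (Fin n)) :=
  SimpleGraph.binomialRandom (Fin n) (Set.projIcc (0 : ℝ) 1 zero_le_one q)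

/-- `G(n, q n)` belongs to the class `𝒞` asymptotically almost surely. -/
def BelongsAAS (q : ℕ → ℝ) (𝒞 : GraphClass) : Prop :=
  Filter.Tendsto (fun n : ℕ => erdosRenyi n (q n) {G | FiniteGraph.of G ∈ 𝒞.carrier})
    Filter.atTop (nhds 1)

end BoundedExpansion

/-! Fix a depth `d` and suppose a minor with `h` vertices and `m` edges has `m / h` large. A.a.s.
the host has `O(n)` edges, so `h` is a small fraction of `n`. Small vertex sets a.a.s. meet few
edges; pulling the set of roots back `d` times along the branch trees shows that `m` is a small
fraction of `n` too (`holdsAAS_ncard_incidentEdges_iterate_le`). One host edge per minor edge,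
together with the tree paths to the roots, gives a set `S` of at most `2 (d + 1) m` vertices
spanning at least `|S| + m - h` edges (`IsShallowModel.exists_dense_subset`). When `m > 2 h` this
exceeds `|S|` by a constant factor, whereas small sets a.a.s. span fewer than `(1 + 1 / r) |S|`
edges (`holdsAAS_ncard_innerEdges_lt`).

The bounds for the separate depths combine into one class by a diagonal choice of `f`: depth `d` is
constrained effectively only once `n` is so large that its failure probability is at most `2⁻ᵈ`. -/

namespace BoundedExpansion

/-! ### Forest models of shallow minors (deterministic). -/

/-- A rooted-forest presentation of a depth-`d` minor model of `H` in `G`: the map `π` sends each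
vertex to its parent, roots being fixed, and `ρ` assigns to the vertices of `H` distinct roots. -/
structure IsShallowModel {V W : Type} (d : ℕ) (G : SimpleGraph V) (H : SimpleGraph W)
    (π : V → V) (ρ : W → V) : Prop where
  parent : ∀ v, π v = v ∨ G.Adj v (π v)
  stable : ∀ v, π (π^[d] v) = π^[d] v
  injective : Function.Injective ρ
  lift : ∀ a b, H.Adj a b → ∃ u v, G.Adj u v ∧ π^[d] u = ρ a ∧ π^[d] v = ρ b

/-- Edges of `G` with at least one end in `S`. -/
def incidentEdges {V : Type} (G : SimpleGraph V) (S : Set V) : Set (Sym2 V) :=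
  {e ∈ G.edgeSet | ∃ v ∈ S, v ∈ e}

/-- Edges of `G` with both ends in `S`. -/
def innerEdges {V : Type} (G : SimpleGraph V) (S : Set V) : Set (Sym2 V) :=
  {e ∈ G.edgeSet | ∀ v ∈ e, v ∈ S}

/-- Root each component at a centre and let `π` move one step along a shortest path to it; the
radius bound makes `d` steps suffice. -/
theorem exists_parentMap {V : Type} {G X : SimpleGraph V} (hX : X ≤ G) {d : ℕ}
    (hr : ∀ C : X.ConnectedComponent, C.toSimpleGraph.radius ≤ (d : ℕ∞)) :
    ∃ (π : V → V) (c : X.ConnectedComponent → V), (∀ v, π v = v ∨ G.Adj v (π v)) ∧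
      (∀ C, π (c C) = c C) ∧ (∀ v, π^[d] v = c (X.connectedComponentMk v)) ∧
      ∀ C, X.connectedComponentMk (c C) = C := by
  classical
  have hc : ∀ C : X.ConnectedComponent, ∃ c : V, X.connectedComponentMk c = C ∧
      ∀ v, X.connectedComponentMk v = C → ∃ p : X.Walk v c, p.length ≤ d := by
    intro C
    have : Nonempty C.supp := C.nonempty_supp.to_subtype
    obtain ⟨u, hu⟩ := C.toSimpleGraph.exists_eccent_eq_radius
    refine ⟨u.1, u.2, fun v hv => ?_⟩
    have hv' : v ∈ C := hv
    have h1 : C.toSimpleGraph.edist ⟨v, hv'⟩ u ≤ d := by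
      rw [SimpleGraph.edist_comm]
      exact SimpleGraph.edist_le_eccent.trans (hu.trans_le (hr C))
    obtain ⟨p, hp⟩ := SimpleGraph.exists_walk_of_edist_ne_top
      (h1.trans_lt (ENat.natCast_lt_top d)).ne
    rw [← hp] at h1
    exact ⟨p.map C.toSimpleGraph_hom, (SimpleGraph.Walk.length_map _ _).trans_le
      (by exact_mod_cast h1)⟩
  choose c hcC hcw using hc
  -- Truncated subtraction covers `v = x`, where the step stays put; this makes centres fixed
  -- points.
  have hstep : ∀ v x, X.Reachable v x → ∃ u, (u = v ∨ X.Adj v u) ∧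
      X.dist u x ≤ X.dist v x - 1 := by
    intro v x hvx
    obtain ⟨w, hw⟩ := hvx.exists_walk_length_eq_dist
    rw [← hw]
    cases w with
    | nil => exact ⟨v, Or.inl rfl, by simp⟩
    | cons hadj q => exact ⟨_, Or.inr hadj, (SimpleGraph.dist_le q).trans (by simp)⟩
  choose π hadj hdist using fun v => hstep v (c (X.connectedComponentMk v))
    ((hcw _ v rfl).elim fun p _ => ⟨p⟩)
  have hcomp : ∀ v, X.connectedComponentMk (π v) = X.connectedComponentMk v := by
    intro v
    rcases hadj v with h | h
    · rw [h]
    · exact (SimpleGraph.ConnectedComponent.connectedComponentMk_eq_of_adj h).symm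
  have hiter : ∀ k v, X.connectedComponentMk (π^[k] v) =
      X.connectedComponentMk v ∧ X.dist (π^[k] v)
        (c (X.connectedComponentMk v)) ≤ X.dist v (c (X.connectedComponentMk v)) - k := by
    intro k
    induction k with
    | zero => intro v; simp
    | succ k ih =>
      intro v
      obtain ⟨h1, h2⟩ := ih v
      rw [Function.iterate_succ_apply']
      refine ⟨(hcomp _).trans h1, ?_⟩
      have h3 := hdist (π^[k] v)
      rw [h1] at h3
      exact h3.trans (by omega)
  refine ⟨π, c, fun v => (hadj v).imp id fun h => hX h, fun C => ?_, fun v => ?_, hcC⟩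
  · have h := hdist (c C)
    rw [hcC, SimpleGraph.dist_self] at h
    have h2 : X.Reachable (π (c C)) (c C) := by
      rw [← SimpleGraph.ConnectedComponent.eq]; exact hcomp _
    exact h2.dist_eq_zero_iff.1 (by omega)
  · obtain ⟨h1, h2⟩ := hiter d v
    have h3 : X.Reachable (π^[d] v) (c (X.connectedComponentMk v)) := by
      rw [← SimpleGraph.ConnectedComponent.eq, h1, hcC]
    refine h3.dist_eq_zero_iff.1 ?_
    obtain ⟨p, hp⟩ := hcw _ v rfl
    have := SimpleGraph.dist_le p
    omega

theorem IsShallowMinor.exists_model {d : ℕ} {H G : FiniteGraph} (h : IsShallowMinor d H G) :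
    ∃ π ρ, IsShallowModel d G.graph H.graph π ρ := by
  obtain ⟨X, hX, hr, ⟨f, hf⟩⟩ := h
  obtain ⟨π, c, hpar, hfix, hit, hcC⟩ := exists_parentMap hX hr
  have hcinj : Function.Injective c := Function.LeftInverse.injective hcC
  refine ⟨π, c ∘ f, hpar, fun v => by rw [hit, hfix], hcinj.comp hf, fun a b hab => ?_⟩
  obtain ⟨-, u, hu, v, hv, huv⟩ := f.map_adj hab
  exact ⟨u, v, huv, (hit u).trans (congrArg c hu), (hit v).trans (congrArg c hv)⟩

section

variable {V W : Type} {d : ℕ} {G : SimpleGraph V} {H : SimpleGraph W} {π : V → V} {ρ : W → V}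

theorem IsShallowModel.map_iso {V' : Type} {G' : SimpleGraph V'}
    (h : IsShallowModel d G H π ρ) (e : G ≃g G') :
    IsShallowModel d G' H (e ∘ π ∘ e.symm) (e ∘ ρ) := by
  have hit : ∀ k v, (e ∘ π ∘ e.symm)^[k] v = e (π^[k] (e.symm v)) := by
    intro k
    induction k with
    | zero => intro v; simp
    | succ k ih => intro v; simp only [Function.iterate_succ_apply', ih]; simp
  refine ⟨fun v => ?_, fun v => ?_, e.injective.comp h.injective, fun a b hab => ?_⟩
  · rcases h.parent (e.symm v) with h1 | h1
    · left; simp [h1]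
    · right; simpa using e.map_adj_iff.2 h1
  · rw [hit]; simp [h.stable]
  · obtain ⟨u, v, huv, hu, hv⟩ := h.lift a b hab
    exact ⟨e u, e v, e.map_adj_iff.2 huv, by simp [hit, hu], by simp [hit, hv]⟩

theorem IsShallowModel.exists_edge (h : IsShallowModel d G H π ρ) (e : H.edgeSet) :
    ∃ e' ∈ G.edgeSet, e'.map π^[d] = e.1.map ρ := by
  obtain ⟨⟨a, b⟩, hab⟩ := e
  obtain ⟨u, v, huv, hu, hv⟩ := h.lift a b hab
  exact ⟨s(u, v), huv, by simp [hu, hv]⟩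

/-- Lifting the edges of a shallow minor to the host graph. -/
theorem IsShallowModel.exists_lift (h : IsShallowModel d G H π ρ) :
    ∃ F : Set (Sym2 V), F ⊆ G.edgeSet ∧ F.ncard = H.edgeSet.ncard ∧
      (∀ e ∈ F, ¬ (e.map π^[d]).IsDiag) ∧ ∀ e ∈ F, ∀ v ∈ e, π^[d] v ∈ Set.range ρ := by
  choose φ hφ hφ' using h.exists_edge
  have hinj : Function.Injective φ := fun a b hab => Subtype.ext <|
    Sym2.map.injective h.injective (by rw [← hφ', ← hφ', hab])
  refine ⟨Set.range φ, ?_, ?_, ?_, ?_⟩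
  · rintro _ ⟨e, rfl⟩; exact hφ e
  · rw [← Set.image_univ, Set.ncard_image_of_injective _ hinj, Set.ncard_univ]; rfl
  · rintro _ ⟨e, rfl⟩
    rw [hφ']
    obtain ⟨⟨a, b⟩, hab⟩ := e
    have hne : a ≠ b := SimpleGraph.Adj.ne hab
    exact fun hd => hne (h.injective hd)
  · rintro _ ⟨e, rfl⟩ v hv
    have : π^[d] v ∈ (φ e).map π^[d] := Sym2.mem_map.2 ⟨v, hv, rfl⟩
    rw [hφ'] at this
    obtain ⟨a, -, ha⟩ := Sym2.mem_map.1 this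
    exact ⟨a, ha⟩

theorem IsShallowModel.ncard_edgeSet_le [Finite V] (h : IsShallowModel d G H π ρ) :
    H.edgeSet.ncard ≤ (incidentEdges G {v | π^[d] v ∈ Set.range ρ}).ncard := by
  obtain ⟨F, hF, hcard, -, hF'⟩ := h.exists_lift
  rw [← hcard]
  refine Set.ncard_le_ncard (fun e he => ⟨hF he, ?_⟩) (Set.toFinite _)
  induction e with
  | _ u v => exact ⟨u, hF' _ he u (Sym2.mem_mk_left u v), Sym2.mem_mk_left u v⟩

/-- Two vertices with the same parent edge would form a 2-cycle of `π`, which is impossible when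
every orbit ends in a fixed point. -/
theorem parentEdge_injOn (hfix : ∀ v, π (π^[d] v) = π^[d] v) :
    Set.InjOn (fun v => s(v, π v)) {v | π v ≠ v} := by
  intro v hv w hw hvw
  rcases Sym2.eq_iff.1 hvw with ⟨h, -⟩ | ⟨h1, h2⟩
  · exact h
  exfalso
  have hfix2 : ∀ k, π^[k] (π^[d] v) = π^[d] v := fun k => Function.iterate_fixed (hfix v) k
  have h3 : π^[2] v = v := by
    change π (π v) = v
    rw [h2, ← h1]
  have h4 : π^[2 * d] v = v := by
    rw [Function.iterate_mul]; exact Function.iterate_fixed h3 d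
  have h5 : π^[d] v = v := by
    rw [two_mul, Function.iterate_add_apply, hfix2] at h4; exact h4
  exact hv (by have := hfix v; rwa [h5] at this)

/-- A shallow minor of large density is carried by few vertices of the host graph which span
many edges. -/
theorem IsShallowModel.exists_dense_subset [Finite V] [Finite W] (h : IsShallowModel d G H π ρ) :
    ∃ S : Set V, S.ncard ≤ 2 * (d + 1) * H.edgeSet.ncard ∧
      S.ncard + H.edgeSet.ncard ≤ (innerEdges G S).ncard + Nat.card W ∧
      (H.edgeSet.Nonempty → S.Nonempty) := by
  classical
  obtain ⟨F, hF, hcard, hdiag, hroot⟩ := h.exists_lift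
  -- `U` collects the ends of the lifted edges, `S` their paths to the roots, each of at most `d +
  -- 1` vertices.
  set U : Set V := {v | ∃ e ∈ F, v ∈ e} with hU
  set S : Set V := ⋃ i ∈ Finset.range (d + 1), π^[i] '' U with hS
  have hUcard : U.ncard ≤ 2 * F.ncard := by
    have : U = ⋃ e ∈ F.toFinite.toFinset, ((e : Sym2 V) : Set V) := by
      ext v; simp [hU]
    rw [this]
    refine (Finset.set_ncard_biUnion_le _ _).trans ?_
    rw [Set.ncard_eq_toFinset_card F, mul_comm]
    refine Finset.sum_le_card_nsmul _ _ 2 fun e _ => ?_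
    induction e with
    | _ u v =>
      rw [Sym2.coe_mk]
      exact (Set.ncard_insert_le _ _).trans (by simp)
  have hUS : U ⊆ S := fun v hv => by
    simp only [hS, Set.mem_iUnion]
    exact ⟨0, by simp, v, hv, rfl⟩
  have hScard : S.ncard ≤ 2 * (d + 1) * F.ncard := by
    refine (Finset.set_ncard_biUnion_le _ _).trans ?_
    refine (Finset.sum_le_card_nsmul _ _ (2 * F.ncard) fun i _ =>
      (Set.ncard_image_le (Set.toFinite _)).trans hUcard).trans ?_
    simp only [Finset.card_range, smul_eq_mul]
    exact le_of_eq (by ring)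
  have hmem : ∀ v ∈ S, ∃ i ≤ d, ∃ u ∈ U, π^[i] u = v := by
    intro v hv
    simp only [hS, Set.mem_iUnion, Finset.mem_range] at hv
    obtain ⟨i, hi, u, hu, rfl⟩ := hv
    exact ⟨i, by omega, u, hu, rfl⟩
  have hclosed : ∀ v ∈ S, π v ∈ S := by
    intro v hv
    obtain ⟨i, hi, u, hu, rfl⟩ := hmem v hv
    rcases hi.lt_or_eq with hi | rfl
    · simp only [hS, Set.mem_iUnion, Finset.mem_range]
      exact ⟨i + 1, by omega, u, hu, Function.iterate_succ_apply' _ _ _⟩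
    · rwa [h.stable]
  have hfixed : (S ∩ {v | π v = v}).ncard ≤ Nat.card W := by
    have hsub : S ∩ {v | π v = v} ⊆ Set.range ρ := by
      rintro v ⟨hv, hfix⟩
      obtain ⟨i, hi, u, ⟨e, he, hue⟩, rfl⟩ := hmem v hv
      have := hroot e he u hue
      rw [← Nat.sub_add_cancel hi, Function.iterate_add_apply,
        Function.iterate_fixed hfix] at this
      exact this
    refine (Set.ncard_le_ncard hsub (Set.toFinite _)).trans ?_
    rw [← Set.image_univ, Set.ncard_image_of_injective _ h.injective, Set.ncard_univ]
  -- One parent edge per non-root of `S`; these lie within branches, while the edges of `F` join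
  -- different branches.
  set T : Set (Sym2 V) := (fun v => s(v, π v)) '' (S \ {v | π v = v}) with hT
  have hTcard : T.ncard = (S \ {v | π v = v}).ncard :=
    ((parentEdge_injOn h.stable).mono fun v hv => hv.2).ncard_image
  have hdisj : Disjoint F T := by
    rw [Set.disjoint_left]
    rintro _ heF ⟨v, -, rfl⟩
    refine hdiag _ heF ?_
    rw [Sym2.map_mk, Sym2.mk_isDiag_iff, ← Function.iterate_succ_apply,
      Function.iterate_succ_apply', h.stable]
  have hsub : F ∪ T ⊆ innerEdges G S := by
    rintro e (he | ⟨v, ⟨hv, hne⟩, rfl⟩)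
    · exact ⟨hF he, fun v hv => hUS ⟨e, he, hv⟩⟩
    · refine ⟨(h.parent v).resolve_left hne, fun w hw => ?_⟩
      rcases Sym2.mem_iff.1 hw with rfl | rfl
      exacts [hv, hclosed _ hv]
  have h1 := Set.ncard_le_ncard hsub (Set.toFinite _)
  rw [Set.ncard_union_eq hdisj (Set.toFinite _) (Set.toFinite _), hTcard] at h1
  have h2 := Set.ncard_inter_add_ncard_sdiff_eq_ncard S {v | π v = v} (Set.toFinite _)
  refine ⟨S, hcard ▸ hScard, ?_, ?_⟩
  · omega
  · intro hne
    have : F.Nonempty := by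
      rw [← Set.ncard_pos, hcard, Set.ncard_pos]
      · exact hne
    obtain ⟨e, he⟩ := this
    induction e with
    | _ u v => exact ⟨u, hUS ⟨_, he, Sym2.mem_mk_left u v⟩⟩

end

end BoundedExpansion

/-! ### First-moment estimates. -/

namespace BoundedExpansion

section

open MeasureTheory Filter Topology ENNReal

theorem choose_le_exp_mul_div_pow (N t : ℕ) :
    (N.choose t : ℝ) ≤ (Real.exp 1 * N / t) ^ t := by
  rcases t.eq_zero_or_pos with rfl | ht
  · simp
  have ht' : (0 : ℝ) < t := by exact_mod_cast ht
  have h1 := Real.pow_div_factorial_le_exp (x := t) ht'.le t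
  have hf : (0 : ℝ) < t.factorial := by exact_mod_cast t.factorial_pos
  rw [div_le_iff₀ hf] at h1
  refine (Nat.choose_le_pow_div t N).trans ?_
  rw [div_pow, mul_pow, ← Real.exp_nat_mul, mul_one, div_le_div_iff₀ hf (by positivity)]
  calc (N : ℝ) ^ t * (t : ℝ) ^ t ≤ (N : ℝ) ^ t * (Real.exp t * t.factorial) := by gcongr
    _ = _ := by ring

/-- Dominated convergence; it serves for union bounds over set sizes and over depths. -/
theorem tendsto_tsum_zero_of_le_geometric {a : ℕ → ℕ → ℝ≥0∞}
    (hle : ∀ n k, a n k ≤ 2⁻¹ ^ k) (hlim : ∀ k, Tendsto (fun n => a n k) atTop (𝓝 0)) :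
    Tendsto (fun n => ∑' k, a n k) atTop (𝓝 0) := by
  have hne : ∀ n k, a n k ≠ ∞ := fun n k => ne_top_of_le_ne_top (by simp) (hle n k)
  have hreal : ∀ n k, (a n k).toReal ≤ (1 / 2 : ℝ) ^ k := by
    intro n k
    have := ENNReal.toReal_mono (by simp) (hle n k)
    simpa using this
  have hsum : ∀ n, Summable fun k => (a n k).toReal := fun n =>
    summable_geometric_two.of_nonneg_of_le (fun _ => ENNReal.toReal_nonneg) (hreal n)
  have hr : Tendsto (fun n => ∑' k, (a n k).toReal) atTop (𝓝 (∑' _ : ℕ, (0 : ℝ))) := by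
    refine tendsto_tsum_of_dominated_convergence summable_geometric_two (fun k => ?_)
      (Eventually.of_forall fun n k => ?_)
    · simpa [Function.comp_def] using (ENNReal.tendsto_toReal zero_ne_top).comp (hlim k)
    · rw [Real.norm_of_nonneg ENNReal.toReal_nonneg]; exact hreal n k
  rw [tsum_zero] at hr
  have h2 := ENNReal.tendsto_ofReal hr
  rw [ENNReal.ofReal_zero] at h2
  refine h2.congr fun n => ?_
  rw [ENNReal.ofReal_tsum_of_nonneg (fun _ => ENNReal.toReal_nonneg) (hsum n)]
  simp_rw [ENNReal.ofReal_toReal (hne n _)]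

instance (n : ℕ) (q : ℝ) : IsProbabilityMeasure (erdosRenyi n q) := by
  unfold erdosRenyi; infer_instance

theorem erdosRenyi_superset_le {n : ℕ} {q : ℝ} (hq : 0 ≤ q) (T : Finset (Sym2 (Fin n))) :
    erdosRenyi n q {G | ↑T ⊆ G.edgeSet} ≤ ENNReal.ofReal (q ^ T.card) := by
  rw [erdosRenyi, SimpleGraph.binomialRandom_apply]
  refine (measure_mono (t := Set.pi T fun _ => {True}) ?_).trans ?_
  · rintro _ ⟨G, hG, rfl⟩ e he
    simpa using hG he
  rw [Measure.infinitePi_pi _ (fun _ _ => .of_discrete), ENNReal.ofReal_pow hq,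
    ← Finset.prod_const]
  refine Finset.prod_le_prod' fun e _ => ?_
  -- For `q > 1` the clamped probability is still at most `q`, so small `n` need no separate
  -- treatment.
  have h1 : (unitInterval.toNNReal (Set.projIcc (0 : ℝ) 1 zero_le_one q) : ℝ≥0∞) ≤
      ENNReal.ofReal q := by
    rw [ENNReal.ofReal, ENNReal.coe_le_coe]
    rw [← NNReal.coe_le_coe, Real.coe_toNNReal _ hq]
    change ((Set.projIcc (0 : ℝ) 1 zero_le_one q : Set.Icc (0 : ℝ) 1) : ℝ) ≤ q
    rw [Set.coe_projIcc]
    exact max_le hq (min_le_right _ _)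
  refine le_trans ?_ h1
  simp only [Measure.coe_add, Pi.add_apply, Measure.coe_nnreal_smul_apply,
    Measure.dirac_apply' _ (MeasurableSet.of_discrete)]
  by_cases h : e.IsDiag <;> simp [Set.indicator, h]

/-- First moment bound for the appearance of `t` edges inside one of several sets of pairs. -/
theorem erdosRenyi_exists_le {n : ℕ} {q : ℝ} (hq : 0 ≤ q) {ι : Type*} (I : Finset ι)
    (Q : ι → Finset (Sym2 (Fin n))) {N : ℝ} (hN : ∀ i ∈ I, ((Q i).card : ℝ) ≤ N) (t : ℕ) :
    erdosRenyi n q {G | ∃ i ∈ I, ∃ F ⊆ G.edgeSet, F ⊆ ↑(Q i) ∧ t ≤ F.ncard} ≤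
      ENNReal.ofReal (I.card * (Real.exp 1 * N * q / t) ^ t) := by
  classical
  have hone : ∀ i ∈ I, erdosRenyi n q (⋃ T ∈ (Q i).powersetCard t, {G | ↑T ⊆ G.edgeSet}) ≤
      ENNReal.ofReal ((Real.exp 1 * N * q / t) ^ t) := by
    intro i hi
    refine (measure_biUnion_finset_le _ _).trans ?_
    refine (Finset.sum_le_card_nsmul _ _ (ENNReal.ofReal (q ^ t)) fun T hT => ?_).trans ?_
    · exact (Finset.mem_powersetCard.1 hT).2 ▸ erdosRenyi_superset_le hq T
    rw [Finset.card_powersetCard, nsmul_eq_mul, ← ENNReal.ofReal_natCast,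
      ← ENNReal.ofReal_mul (by positivity)]
    refine ENNReal.ofReal_le_ofReal ?_
    calc ((Q i).card.choose t : ℝ) * q ^ t
        ≤ (Real.exp 1 * (Q i).card / t) ^ t * q ^ t := by
          gcongr; exact choose_le_exp_mul_div_pow _ _
      _ = (Real.exp 1 * (Q i).card * q / t) ^ t := by rw [← mul_pow]; ring
      _ ≤ _ := by have := hN i hi; gcongr
  refine (measure_mono (t := ⋃ i ∈ I, ⋃ T ∈ (Q i).powersetCard t, {G | ↑T ⊆ G.edgeSet}) ?_).trans
    ((measure_biUnion_finset_le _ _).trans ?_)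
  · rintro G ⟨i, hi, F, hFG, hFQ, ht⟩
    obtain ⟨T, hTF, hT⟩ := Set.exists_subset_card_eq ht
    simp only [Set.mem_iUnion]
    refine ⟨i, hi, (Set.toFinite T).toFinset, ?_, ?_⟩
    · rw [Finset.mem_powersetCard, ← Set.ncard_eq_toFinset_card T]
      refine ⟨?_, hT⟩
      rw [Set.Finite.toFinset_subset]
      exact hTF.trans hFQ
    · simpa using hTF.trans hFG
  refine (Finset.sum_le_card_nsmul _ _ _ hone).trans ?_
  rw [nsmul_eq_mul, ← ENNReal.ofReal_natCast, ← ENNReal.ofReal_mul (by positivity)]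

/-- The graph property `P` holds for `G(n, p / n)` asymptotically almost surely. -/
def HoldsAAS (p : ℝ) (P : ∀ n, SimpleGraph (Fin n) → Prop) : Prop :=
  Tendsto (fun n : ℕ => erdosRenyi n (p / n) {G | ¬ P n G}) atTop (𝓝 0)

theorem HoldsAAS.mono {p : ℝ} {P P' : ∀ n, SimpleGraph (Fin n) → Prop} (h : HoldsAAS p P)
    (hP : ∀ n G, P n G → P' n G) : HoldsAAS p P' :=
  tendsto_of_tendsto_of_tendsto_of_le_of_le tendsto_const_nhds h (fun _ => zero_le)
    fun n => measure_mono fun G hG hPG => hG (hP n G hPG)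

theorem HoldsAAS.and {p : ℝ} {P P' : ∀ n, SimpleGraph (Fin n) → Prop} (h : HoldsAAS p P)
    (h' : HoldsAAS p P') : HoldsAAS p fun n G => P n G ∧ P' n G := by
  have := Tendsto.add h h'
  rw [add_zero] at this
  refine tendsto_of_tendsto_of_tendsto_of_le_of_le tendsto_const_nhds this (fun _ => zero_le)
    fun n => (measure_mono ?_).trans (measure_union_le _ _)
  intro G hG
  exact not_and_or.1 hG

theorem holdsAAS_of_le_half_pow {p : ℝ} {P : ∀ n, SimpleGraph (Fin n) → Prop}
    (h : ∀ n : ℕ, 0 < n → erdosRenyi n (p / n) {G | ¬ P n G} ≤ ENNReal.ofReal ((1 / 2) ^ n)) :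
    HoldsAAS p P := by
  have h0 : Tendsto (fun n : ℕ => ENNReal.ofReal ((1 / 2) ^ n)) atTop (𝓝 0) := by
    rw [← ENNReal.ofReal_zero]
    exact ENNReal.tendsto_ofReal
      (tendsto_pow_atTop_nhds_zero_of_lt_one (by norm_num) (by norm_num))
  refine tendsto_of_tendsto_of_tendsto_of_le_of_le' tendsto_const_nhds h0
    (Eventually.of_forall fun _ => zero_le) ?_
  filter_upwards [eventually_gt_atTop 0] with n hn using h n hn

theorem holdsAAS_ncard_edgeSet_le {p : ℝ} (hp : 0 < p) :
    ∃ C : ℕ, HoldsAAS p fun n G => G.edgeSet.ncard ≤ C * n := by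
  -- Since `e < 3`, this gives `e p / C ≤ 1 / 2`.
  obtain ⟨C, hC⟩ := exists_nat_ge (6 * p)
  have hC0 : 0 < C := by
    rcases C.eq_zero_or_pos with rfl | h
    · simp at hC; linarith
    · exact h
  refine ⟨C, holdsAAS_of_le_half_pow fun n hn => ?_⟩
  have hn' : (0 : ℝ) < n := by exact_mod_cast hn
  have hC' : (0 : ℝ) < C := by exact_mod_cast hC0
  have hb := erdosRenyi_exists_le (n := n) (q := p / n) (by positivity) {()}
    (fun _ => Finset.univ) (N := (n : ℝ) ^ 2) (fun _ _ => by
      rw [Finset.card_univ, Sym2.card, Fintype.card_fin, Nat.choose_two_right]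
      have : (n + 1) * (n + 1 - 1) / 2 ≤ n ^ 2 := by
        apply Nat.div_le_of_le_mul; simp; nlinarith
      exact_mod_cast this) (C * n)
  refine (measure_mono ?_).trans (hb.trans (ENNReal.ofReal_le_ofReal ?_))
  · intro G hG
    exact ⟨(), by simp, G.edgeSet, subset_rfl, by simp, (not_le.1 hG).le⟩
  · have he := Real.exp_one_lt_three
    have hle : Real.exp 1 * (n : ℝ) ^ 2 * (p / n) / ((C * n : ℕ) : ℝ) ≤ 1 / 2 := by
      have : Real.exp 1 * (n : ℝ) ^ 2 * (p / n) / ((C * n : ℕ) : ℝ) = Real.exp 1 * p / C := by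
        push_cast; field_simp
      rw [this, div_le_div_iff₀ hC' two_pos]
      nlinarith
    rw [Finset.card_singleton, Nat.cast_one, one_mul]
    refine (pow_le_pow_left₀ (by positivity) hle _).trans ?_
    exact pow_le_pow_of_le_one (by norm_num) (by norm_num) (Nat.le_mul_of_pos_left n hC0)

/-- Small vertex sets meet few edges. -/
theorem holdsAAS_ncard_incidentEdges_le {p : ℝ} (hp : 0 < p) {η : ℝ} (hη : 0 < η) :
    ∃ γ : ℝ, 0 < γ ∧ γ ≤ η ∧ HoldsAAS p fun n G => ∀ S : Set (Fin n), (S.ncard : ℝ) ≤ γ * n →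
      ((incidentEdges G S).ncard : ℝ) ≤ η * n := by
  classical
  -- With `t ≥ η n` we get `M t ≥ n`, so `a ^ t ≤ 4⁻ⁿ` beats the at most `2ⁿ` choices of `S`.
  obtain ⟨M, hM⟩ := exists_nat_ge (1 / η)
  set a : ℝ := (1 / 4) ^ M with ha
  have ha0 : 0 < a := by positivity
  refine ⟨min η (a * η / (Real.exp 1 * p)), lt_min hη (by positivity), min_le_left _ _,
    holdsAAS_of_le_half_pow fun n hn => ?_⟩
  set γ := min η (a * η / (Real.exp 1 * p)) with hγ
  have hγ0 : 0 < γ := lt_min hη (by positivity)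
  have hγa : Real.exp 1 * γ * p / η ≤ a := by
    have h1 : γ ≤ a * η / (Real.exp 1 * p) := min_le_right _ _
    rw [le_div_iff₀ (by positivity)] at h1
    rw [div_le_iff₀ hη]
    linarith
  have hn' : (0 : ℝ) < n := by exact_mod_cast hn
  set t := ⌈η * n⌉₊ with ht
  have htle : η * n ≤ t := Nat.le_ceil _
  have hb := erdosRenyi_exists_le (n := n) (q := p / n) (by positivity)
    (Finset.univ.filter fun S : Finset (Fin n) => (S.card : ℝ) ≤ γ * n)
    (fun S => (S ×ˢ Finset.univ).image fun x => s(x.1, x.2)) (N := γ * n * n) (fun S hS => by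
      have h1 : ((S ×ˢ Finset.univ).image fun x : Fin n × Fin n => s(x.1, x.2)).card
          ≤ S.card * n := Finset.card_image_le.trans (by simp)
      have h2 : (((S ×ˢ Finset.univ).image fun x : Fin n × Fin n => s(x.1, x.2)).card : ℝ)
          ≤ S.card * n := by exact_mod_cast h1
      refine h2.trans ?_
      have h3 := (Finset.mem_filter.1 hS).2
      gcongr) t
  refine (measure_mono ?_).trans (hb.trans (ENNReal.ofReal_le_ofReal ?_))
  · intro G hG
    simp only [Set.mem_ofPred_eq, not_forall, not_le] at hG
    obtain ⟨S, hS, hlt⟩ := hG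
    refine ⟨(Set.toFinite S).toFinset, ?_, incidentEdges G S, fun e he => he.1, ?_, ?_⟩
    · rw [Finset.mem_filter, ← Set.ncard_eq_toFinset_card S]
      exact ⟨Finset.mem_univ _, hS⟩
    · rintro e ⟨-, v, hv, hve⟩
      obtain ⟨w, rfl⟩ := hve
      simp only [Finset.coe_image, Set.mem_image]
      exact ⟨(v, w), by simpa using hv, rfl⟩
    · exact Nat.ceil_le.2 hlt.le
  · have hbase : Real.exp 1 * (γ * n * n) * (p / n) / t ≤ a := by
      refine le_trans ?_ hγa
      have : Real.exp 1 * (γ * n * n) * (p / n) = Real.exp 1 * γ * p * n := by field_simp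
      rw [this]
      have hηn : 0 < η * n := by positivity
      calc Real.exp 1 * γ * p * n / t ≤ Real.exp 1 * γ * p * n / (η * n) := by gcongr
        _ = _ := by field_simp
    have hcard : ((Finset.univ.filter fun S : Finset (Fin n) =>
        (S.card : ℝ) ≤ γ * n).card : ℝ) ≤ 2 ^ n := by
      have := Finset.card_filter_le (Finset.univ : Finset (Finset (Fin n)))
        (fun S => (S.card : ℝ) ≤ γ * n)
      rw [Finset.card_univ, Fintype.card_finset, Fintype.card_fin] at this
      exact_mod_cast this
    have hMt : n ≤ M * t := by
      rw [div_le_iff₀ hη] at hM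
      have : (n : ℝ) ≤ M * t := by
        calc (n : ℝ) = 1 * n := (one_mul _).symm
          _ ≤ (M * η) * n := by gcongr
          _ = M * (η * n) := by ring
          _ ≤ M * t := by gcongr
      exact_mod_cast this
    calc _ ≤ (2 : ℝ) ^ n * a ^ t := by
          gcongr
      _ = 2 ^ n * (1 / 4) ^ (M * t) := by rw [ha, pow_mul]
      _ ≤ 2 ^ n * (1 / 4) ^ n := by
          gcongr ?_ * ?_
          exact pow_le_pow_of_le_one (by norm_num) (by norm_num) hMt
      _ = (1 / 2) ^ n := by rw [← mul_pow]; norm_num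

/-- Iterated version of `holdsAAS_ncard_incidentEdges_le` for trees of bounded depth. -/
theorem holdsAAS_ncard_incidentEdges_iterate_le {p : ℝ} (hp : 0 < p) (j : ℕ) {η : ℝ}
    (hη : 0 < η) :
    ∃ γ : ℝ, 0 < γ ∧ HoldsAAS p fun n G => ∀ π : Fin n → Fin n, (∀ v, π v = v ∨ G.Adj v (π v)) →
      Set.InjOn (fun v => s(v, π v)) {v | π v ≠ v} →
      ∀ S : Set (Fin n), (S.ncard : ℝ) ≤ γ * n →
        ((incidentEdges G {v | π^[j] v ∈ S}).ncard : ℝ) ≤ η * n := by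
  induction j with
  | zero =>
    obtain ⟨γ, hγ, -, h⟩ := holdsAAS_ncard_incidentEdges_le hp hη
    exact ⟨γ, hγ, h.mono fun n G hG π _ _ S hS => hG S hS⟩
  | succ j ih =>
    obtain ⟨γ₁, hγ₁, h₁⟩ := ih
    -- Half of `γ₁` pays for `S` itself, half for its children, which inject into the edges meeting
    -- `S`. Only vertex sets enter the random event, so it serves all `π` at once.
    obtain ⟨γ, hγ, hγle, h⟩ := holdsAAS_ncard_incidentEdges_le hp (half_pos hγ₁)
    refine ⟨γ, hγ, (h₁.and h).mono fun n G ⟨hG₁, hG⟩ π hπ hinj S hS => ?_⟩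
    simp only [Function.iterate_succ_apply']
    refine hG₁ π hπ hinj {v | π v ∈ S} ?_
    have hsub : {v | π v ∈ S} ⊆ S ∪ {v | π v ≠ v ∧ π v ∈ S} := by
      intro v hv
      by_cases hfix : π v = v
      · left; have hv' : π v ∈ S := hv; rwa [hfix] at hv'
      · exact Or.inr ⟨hfix, hv⟩
    have h1 := (Set.ncard_le_ncard hsub (Set.toFinite _)).trans (Set.ncard_union_le _ _)
    have h2 : {v | π v ≠ v ∧ π v ∈ S}.ncard ≤ (incidentEdges G S).ncard := by
      refine Set.ncard_le_ncard_of_injOn (fun v => s(v, π v)) ?_ (hinj.mono fun v hv => hv.1)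
        (Set.toFinite _)
      rintro v ⟨hv, hvS⟩
      exact ⟨(hπ v).resolve_left hv, π v, hvS, Sym2.mem_mk_right _ _⟩
    have h3 := hG S hS
    have h4 : ({v | π v ∈ S}.ncard : ℝ) ≤ S.ncard + (incidentEdges G S).ncard := by
      exact_mod_cast h1.trans (by omega)
    have hn : (0 : ℝ) ≤ n := by positivity
    nlinarith

end

end BoundedExpansion

/-! ### Edges spanned by small vertex sets. -/

namespace BoundedExpansion

section

open MeasureTheory Filter Topology ENNReal

/-- The first `k` of the `t` edges cancel the entropy factor `(e n / k) ^ k` up to constants; the `k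
/ r` further ones leave the gain `y ^ k`. -/
theorem choose_mul_pow_le {p B y : ℝ} {n k r t : ℕ} (hp : 0 < p) (hB : 1 ≤ B)
    (hpB : Real.exp 1 * p ≤ B) (hk : 0 < k) (hn : 0 < n) (hy0 : 0 ≤ y) (hy1 : y ≤ 1)
    (hy : y ^ r = B * k / n) (hkt : k ≤ t) (ht : (r + 1) * k ≤ r * t) :
    (n.choose k : ℝ) * (Real.exp 1 * (k : ℝ) ^ 2 * (p / n) / t) ^ t ≤
      (Real.exp 1 * B * y) ^ k := by
  have hk' : (0 : ℝ) < k := by exact_mod_cast hk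
  have hn' : (0 : ℝ) < n := by exact_mod_cast hn
  have hkt' : (k : ℝ) ≤ t := by exact_mod_cast hkt
  have h1 : Real.exp 1 * (k : ℝ) ^ 2 * (p / n) / t ≤ y ^ r := by
    rw [hy]
    calc Real.exp 1 * (k : ℝ) ^ 2 * (p / n) / t
        ≤ Real.exp 1 * (k : ℝ) ^ 2 * (p / n) / k := by gcongr
      _ = (Real.exp 1 * p) * k / n := by field_simp
      _ ≤ B * k / n := by gcongr
  calc (n.choose k : ℝ) * (Real.exp 1 * (k : ℝ) ^ 2 * (p / n) / t) ^ t
      ≤ (Real.exp 1 * n / k) ^ k * (y ^ r) ^ t := by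
        gcongr
        exact choose_le_exp_mul_div_pow _ _
    _ = (Real.exp 1 * n / k) ^ k * y ^ (r * t) := by rw [pow_mul]
    _ ≤ (Real.exp 1 * n / k) ^ k * y ^ ((r + 1) * k) := by
        gcongr ?_ * ?_
        exact pow_le_pow_of_le_one hy0 hy1 ht
    _ = (Real.exp 1 * n / k * (y ^ r * y)) ^ k := by
        rw [mul_pow _ (y ^ r * y), pow_mul, pow_succ]
    _ = (Real.exp 1 * B * y) ^ k := by
        rw [hy]; congr 1; field_simp

/-- Small vertex sets span few edges. -/
theorem holdsAAS_ncard_innerEdges_lt {p : ℝ} (hp : 0 < p) {r : ℕ} (hr : 0 < r) :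
    ∃ δ : ℝ, 0 < δ ∧ HoldsAAS p fun n G => ∀ S : Set (Fin n), S.Nonempty →
      (S.ncard : ℝ) ≤ δ * n → r * (innerEdges G S).ncard < (r + 1) * S.ncard := by
  classical
  set B := max 1 (Real.exp 1 * p) with hB
  have hB1 : 1 ≤ B := le_max_left _ _
  have hpB : Real.exp 1 * p ≤ B := le_max_right _ _
  have hB0 : 0 < B := by linarith
  have he : 1 ≤ Real.exp 1 := Real.one_le_exp zero_le_one
  -- Chosen so that `e B y₀ = 1 / 2`; then `δ` is such that `k ≤ δ n` forces `y n k ≤ y₀`.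
  set y₀ : ℝ := 1 / (2 * (Real.exp 1 * B)) with hy₀
  have hy₀0 : 0 < y₀ := by positivity
  have hy₀1 : y₀ ≤ 1 := by
    rw [hy₀, div_le_one (by positivity)]
    nlinarith
  set δ := y₀ ^ r / B with hδ
  refine ⟨δ, by positivity, ?_⟩
  set E : ∀ n : ℕ, ℕ → Set (SimpleGraph (Fin n)) := fun n k => {G | ∃ S : Set (Fin n),
    S.ncard = k ∧ 0 < k ∧ (k : ℝ) ≤ δ * n ∧ (r + 1) * k ≤ r * (innerEdges G S).ncard} with hE
  set y : ℕ → ℕ → ℝ := fun n k => (B * k / n) ^ ((r : ℝ)⁻¹) with hydef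
  have hynn : ∀ n k, 0 ≤ y n k := fun n k => by positivity
  have hypow : ∀ n k, y n k ^ r = B * k / n := fun n k =>
    Real.rpow_inv_natCast_pow (by positivity) hr.ne'
  have hEle : ∀ n k, erdosRenyi n (p / n) (E n k) ≤ ENNReal.ofReal ((Real.exp 1 * B * y n k) ^ k)
      ∧ erdosRenyi n (p / n) (E n k) ≤ 2⁻¹ ^ k := by
    intro n k
    by_cases hcond : 0 < k ∧ (k : ℝ) ≤ δ * n
    swap
    · have : E n k = ∅ := by
        ext G
        simp only [hE, Set.mem_ofPred_eq, Set.mem_empty_iff_false, iff_false]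
        rintro ⟨S, -, h1, h2, -⟩
        exact hcond ⟨h1, h2⟩
      simp [this]
    obtain ⟨hk, hkδ⟩ := hcond
    have hk' : (0 : ℝ) < k := by exact_mod_cast hk
    have hn : 0 < n := by
      rcases n.eq_zero_or_pos with rfl | h
      · simp at hkδ; omega
      · exact h
    have hn' : (0 : ℝ) < n := by exact_mod_cast hn
    have hyle : y n k ≤ y₀ := by
      rw [← pow_le_pow_iff_left₀ (hynn n k) hy₀0.le hr.ne', hypow, div_le_iff₀ hn']
      calc B * k ≤ B * (δ * n) := by gcongr
        _ = y₀ ^ r * n := by rw [hδ]; field_simp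
    -- This is `k + ⌈k / r⌉`, the least `t` with `(r + 1) k ≤ r t`.
    set t := k + (k + r - 1) / r with ht
    have hrt : (r + 1) * k ≤ r * t := by
      have : k ≤ r * ((k + r - 1) / r) := by
        have h1 := Nat.div_add_mod (k + r - 1) r
        have h2 := Nat.mod_lt (k + r - 1) hr
        omega
      rw [ht, mul_add]; linarith
    have hleast : ∀ s, (r + 1) * k ≤ r * s → t ≤ s := by
      intro s hs
      have hks : k ≤ s := by nlinarith
      obtain ⟨u, rfl⟩ := Nat.exists_eq_add_of_le hks
      have hu : k ≤ r * u := by nlinarith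
      have : (k + r - 1) / r ≤ u := by
        rw [← Nat.lt_succ_iff, Nat.div_lt_iff_lt_mul hr]
        rw [Nat.succ_mul, mul_comm u r]; omega
      omega
    have hb := erdosRenyi_exists_le (n := n) (q := p / n) (by positivity)
      (Finset.univ.powersetCard k) (fun S : Finset (Fin n) => S.sym2) (N := (k : ℝ) ^ 2)
      (fun S hS => by
        rw [Finset.card_sym2, (Finset.mem_powersetCard.1 hS).2, Nat.choose_two_right]
        have : (k + 1) * (k + 1 - 1) / 2 ≤ k ^ 2 := by
          apply Nat.div_le_of_le_mul; simp; nlinarith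
        exact_mod_cast this) t
    have hmain : erdosRenyi n (p / n) (E n k) ≤
        ENNReal.ofReal ((Real.exp 1 * B * y n k) ^ k) := by
      refine (measure_mono ?_).trans (hb.trans (ENNReal.ofReal_le_ofReal ?_))
      · rintro G ⟨S, hS, -, -, hGS⟩
        refine ⟨(Set.toFinite S).toFinset, ?_, innerEdges G S, fun e he => he.1, ?_,
          hleast _ hGS⟩
        · rw [Finset.mem_powersetCard, ← Set.ncard_eq_toFinset_card S]
          exact ⟨Finset.subset_univ _, hS⟩
        · intro e he
          rw [Finset.mem_coe, Finset.mem_sym2_iff]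
          intro v hv
          simpa using he.2 v hv
      · rw [Finset.card_powersetCard, Finset.card_univ, Fintype.card_fin]
        exact choose_mul_pow_le hp hB1 hpB hk hn (hynn n k) (hyle.trans hy₀1) (hypow n k)
          (Nat.le_add_right _ _) hrt
    refine ⟨hmain, hmain.trans ?_⟩
    have h2 : Real.exp 1 * B * y n k ≤ 2⁻¹ := by
      calc Real.exp 1 * B * y n k ≤ Real.exp 1 * B * y₀ := by gcongr
        _ = 2⁻¹ := by rw [hy₀]; field_simp
    rw [ENNReal.ofReal_pow (by have := hynn n k; positivity)]
    gcongr
    refine (ENNReal.ofReal_le_ofReal h2).trans ?_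
    rw [ENNReal.ofReal_inv_of_pos two_pos]; simp
  have hlim : ∀ k, Tendsto (fun n => erdosRenyi n (p / n) (E n k)) atTop (𝓝 0) := by
    intro k
    rcases k.eq_zero_or_pos with rfl | hk
    · have : ∀ n, E n 0 = ∅ := fun n => by ext G; simp [hE]
      simp [this]
    have h1 : Tendsto (fun n : ℕ => B * k / n) atTop (𝓝 0) :=
      tendsto_const_div_atTop_nhds_zero_nat _
    have h2 : Tendsto (fun n => y n k) atTop (𝓝 0) := by
      have := h1.rpow_const (p := (r : ℝ)⁻¹) (Or.inr (by positivity))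
      rwa [Real.zero_rpow (by positivity)] at this
    have h3 := ENNReal.tendsto_ofReal ((h2.const_mul (Real.exp 1 * B)).pow k)
    rw [mul_zero, zero_pow hk.ne', ENNReal.ofReal_zero] at h3
    exact tendsto_of_tendsto_of_tendsto_of_le_of_le tendsto_const_nhds h3 (fun _ => zero_le)
      fun n => (hEle n k).1
  have hsum := tendsto_tsum_zero_of_le_geometric (fun n k => (hEle n k).2) hlim
  refine tendsto_of_tendsto_of_tendsto_of_le_of_le tendsto_const_nhds hsum (fun _ => zero_le)
    fun n => (measure_mono ?_).trans (measure_iUnion_le _)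
  intro G hG
  simp only [Set.mem_ofPred_eq, not_forall, not_lt] at hG
  obtain ⟨S, hne, hS, hGS⟩ := hG
  exact Set.mem_iUnion.2 ⟨S.ncard, S, rfl, hne.ncard_pos (Set.toFinite _), hS, hGS⟩

/-! ### Density of shallow minors and the final class. -/

/-- Every shallow minor of `G` at depth `d` has density at most `c`. -/
def ShallowDensityLE {V : Type} (d : ℕ) (c : ℝ) (G : SimpleGraph V) : Prop :=
  ∀ (H : FiniteGraph) (π : V → V) (ρ : H.V → V), IsShallowModel d G H.graph π ρ → H.density ≤ c

theorem ShallowDensityLE.mono {V : Type} {d : ℕ} {c c' : ℝ} {G : SimpleGraph V}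
    (h : ShallowDensityLE d c G) (hc : c ≤ c') : ShallowDensityLE d c' G :=
  fun H π ρ hm => (h H π ρ hm).trans hc

theorem ShallowDensityLE.of_iso {V V' : Type} {d : ℕ} {c : ℝ} {G : SimpleGraph V}
    {G' : SimpleGraph V'} (h : ShallowDensityLE d c G) (e : G ≃g G') : ShallowDensityLE d c G' :=
  fun H _ _ hm => h H _ _ (hm.map_iso e.symm)

/-- Handles the graphs too small for the probabilistic bound at depth `d`. -/
theorem shallowDensityLE_card {n : ℕ} (d : ℕ) (G : SimpleGraph (Fin n)) :
    ShallowDensityLE d n G := by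
  classical
  intro H π ρ hm
  have := H.finite
  have := Fintype.ofFinite H.V
  have hV : Nat.card H.V ≤ n := by
    simpa using Nat.card_le_card_of_injective ρ hm.injective
  have hE : H.graph.edgeSet.ncard ≤ Nat.card H.V * Nat.card H.V := by
    rw [← SimpleGraph.coe_edgeFinset, Set.ncard_coe_finset, Nat.card_eq_fintype_card]
    refine H.graph.card_edgeFinset_le_card_choose_two.trans ?_
    rw [Nat.choose_two_right]
    exact (Nat.div_le_self _ _).trans (Nat.mul_le_mul_left _ (Nat.sub_le _ _))
  rw [FiniteGraph.density]
  refine div_le_of_le_mul₀ (by positivity) (by positivity) ?_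
  exact_mod_cast hE.trans (Nat.mul_le_mul_right _ hV)

/-- For every fixed depth, the shallow minors of the sparse random graph have bounded density. -/
theorem exists_holdsAAS_shallowDensityLE {p : ℝ} (hp : 0 < p) (d : ℕ) :
    ∃ c : ℝ, HoldsAAS p fun _ G => ShallowDensityLE d c G := by
  -- From `|S| ≤ (r / 2) m` and `2 e(S) ≥ 2 |S| + m` it follows that `r e(S) ≥ (r + 1) |S|`, the
  -- desired contradiction.
  set r := 4 * (d + 1) with hr
  obtain ⟨C, hC⟩ := holdsAAS_ncard_edgeSet_le hp
  obtain ⟨δ, hδ, h₁⟩ := holdsAAS_ncard_innerEdges_lt hp (r := r) (by omega)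
  obtain ⟨γ, hγ, h₂⟩ := holdsAAS_ncard_incidentEdges_iterate_le hp d
    (η := δ / (2 * (d + 1))) (by positivity)
  -- Density above `2` gives `2 h < m`; density above `C / γ` with `m ≤ C n` gives `h ≤ γ n`.
  refine ⟨max 2 (C / γ), ((hC.and h₁).and h₂).mono ?_⟩
  rintro n G ⟨⟨hGC, hG₁⟩, hG₂⟩ H π ρ hm
  have := H.finite
  set m := H.graph.edgeSet.ncard with hmdef
  set h := Nat.card H.V with hhdef
  have hmE : m ≤ G.edgeSet.ncard :=
    hm.ncard_edgeSet_le.trans (Set.ncard_le_ncard (fun e he => he.1) (Set.toFinite _))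
  by_contra hlt
  rw [not_le, FiniteGraph.density, max_lt_iff, ← hmdef, ← hhdef] at hlt
  -- A minor without vertices has density `0` by convention.
  have hh : 0 < (h : ℝ) := by
    by_contra h0
    have : (h : ℝ) = 0 := le_antisymm (not_lt.1 h0) (by positivity)
    rw [this, _root_.div_zero] at hlt
    linarith [hlt.1]
  have h2h : 2 * h < m := by
    have := (lt_div_iff₀ hh).1 hlt.1
    exact_mod_cast this
  have hsmall : (h : ℝ) ≤ γ * n := by
    have h3 := (lt_div_iff₀ hh).1 hlt.2
    have h4 : (m : ℝ) ≤ C * n := by exact_mod_cast hmE.trans hGC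
    rw [div_mul_eq_mul_div, div_lt_iff₀ hγ] at h3
    rcases C.eq_zero_or_pos with hC0 | hC0
    · rw [hC0] at h4
      have : (0 : ℝ) < m := by exact_mod_cast (by omega : 0 < m)
      simp at h4
      linarith
    · have hC' : (0 : ℝ) < C := by exact_mod_cast hC0
      have h5 : (C : ℝ) * h < C * (γ * n) := by nlinarith
      exact (lt_of_mul_lt_mul_left h5 hC'.le).le
  have hinc := hG₂ π hm.parent (parentEdge_injOn hm.stable) (Set.range ρ) (by
    rw [← Set.image_univ, Set.ncard_image_of_injective _ hm.injective, Set.ncard_univ]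
    exact hsmall)
  have hmδ : (m : ℝ) ≤ δ / (2 * (d + 1)) * n :=
    le_trans (by exact_mod_cast hm.ncard_edgeSet_le) hinc
  obtain ⟨S, hS1, hS2, hS3⟩ := hm.exists_dense_subset
  have hSδ : (S.ncard : ℝ) ≤ δ * n := by
    have h6 : (S.ncard : ℝ) ≤ 2 * (d + 1) * m := by exact_mod_cast hS1
    calc (S.ncard : ℝ) ≤ 2 * (d + 1) * m := h6
      _ ≤ 2 * (d + 1) * (δ / (2 * (d + 1)) * n) := by gcongr
      _ = δ * n := by field_simp
  have hne : H.graph.edgeSet.Nonempty := by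
    rw [← Set.ncard_pos (Set.toFinite _)]; omega
  have hlast := hG₁ S (hS3 hne) hSδ
  rw [← hmdef] at hS1 hS2
  rw [← hhdef] at hS2
  have h7 : 2 * S.ncard + m ≤ 2 * (innerEdges G S).ncard := by omega
  have h8 : r * (2 * S.ncard + m) ≤ r * (2 * (innerEdges G S).ncard) := Nat.mul_le_mul_left _ h7
  have h9 : r * m = 2 * (2 * (d + 1) * m) := by rw [hr]; ring
  nlinarith

theorem exists_boundedExpansion_class_of_holdsAAS {p : ℝ}
    (hlocal : ∀ d : ℕ, ∃ c : ℝ, HoldsAAS p fun _ G => ShallowDensityLE d c G) :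
    ∃ 𝓡 : GraphClass, 𝓡.HasBoundedExpansion ∧ BelongsAAS (fun n : ℕ => p / (n : ℝ)) 𝓡 := by
  choose c hc using hlocal
  have hN : ∀ d, ∃ N : ℕ, ∀ n ≥ N,
      erdosRenyi n (p / n) {G | ¬ ShallowDensityLE d (c d) G} ≤ 2⁻¹ ^ d := fun d =>
    eventually_atTop.1 ((hc d).eventually_le_const (ENNReal.pow_pos (by simp) d))
  choose N hN using hN
  set f : ℕ → ℝ := fun d => max (c d) (N d) with hf
  let 𝓡 : GraphClass :=
    { carrier := {G | ∀ d, ShallowDensityLE d (f d) G.graph}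
      iso_closed := fun G H ⟨e⟩ hG d => (hG d).of_iso e }
  refine ⟨𝓡, ⟨f, fun d => ?_⟩, ?_⟩
  · refine iSup₂_le fun H hH => ?_
    obtain ⟨G, hG, hHG⟩ := hH
    obtain ⟨π, ρ, hm⟩ := hHG.exists_model
    exact EReal.coe_le_coe_iff.2 (hG d H π ρ hm)
  set E : ∀ n : ℕ, ℕ → Set (SimpleGraph (Fin n)) := fun n d =>
    {G | N d ≤ n ∧ ¬ ShallowDensityLE d (c d) G} with hE
  have hsum : Tendsto (fun n => ∑' d, erdosRenyi n (p / n) (E n d)) atTop (𝓝 0) := by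
    refine tendsto_tsum_zero_of_le_geometric (fun n d => ?_) fun d => ?_
    · by_cases h : N d ≤ n
      · exact (measure_mono fun G hG => hG.2).trans (hN d n h)
      · simp [hE, h]
    · exact tendsto_of_tendsto_of_tendsto_of_le_of_le tendsto_const_nhds (hc d)
        (fun _ => zero_le) fun n => measure_mono fun G hG => hG.2
  have hbad : Tendsto (fun n : ℕ => erdosRenyi n (p / n) {G | FiniteGraph.of G ∈ 𝓡.carrier}ᶜ)
      atTop (𝓝 0) := by
    refine tendsto_of_tendsto_of_tendsto_of_le_of_le tendsto_const_nhds hsum (fun _ => zero_le)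
      fun n => (measure_mono ?_).trans (measure_iUnion_le _)
    intro G hG
    obtain ⟨d, hd⟩ := not_forall.1 hG
    refine Set.mem_iUnion.2 ⟨d, ?_, fun h => hd (h.mono (le_max_left _ _))⟩
    by_contra hlt
    refine hd ((shallowDensityLE_card d G).mono ?_)
    exact le_max_of_le_right (by exact_mod_cast (not_le.1 hlt).le)
  have h1 := ENNReal.Tendsto.sub (tendsto_const_nhds (x := (1 : ℝ≥0∞))) hbad (Or.inl one_ne_top)
  rw [tsub_zero] at h1
  refine tendsto_of_tendsto_of_tendsto_of_le_of_le h1 tendsto_const_nhds (fun n => ?_)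
    fun n => prob_le_one
  rw [tsub_le_iff_right, ← measure_univ (μ := erdosRenyi n (p / n)),
    ← Set.union_compl_self {G | FiniteGraph.of G ∈ 𝓡.carrier}]
  exact measure_union_le _ _

end

end BoundedExpansion

theorem mainTheorem1 (p : ℝ) (hp : 0 < p) :
    ∃ 𝓡 : BoundedExpansion.GraphClass, 𝓡.HasBoundedExpansion ∧
      BoundedExpansion.BelongsAAS (fun n : ℕ => p / (n : ℝ)) 𝓡 :=
  BoundedExpansion.exists_boundedExpansion_class_of_holdsAAS fun d =>
    BoundedExpansion.exists_holdsAAS_shallowDensityLE hp d
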